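/- Let $k$ be a field with the discrete topology. A topological $k$-vector space is topologically-free if it is isomorphic (linearly and homeomorphically) to a power $k^X$ with the product topology, for some set $X$. For a topological vector space $M$ let $M'$ be the space of continuous linear functionals $M\to k$, and for a vector space $V$ let $V^*$ be its algebraic dual with the weak-$*$ topology (the initial topology induced by the evaluations at the points of $V$). The category $\mathbf{TopFreeVect}_k$ of topologically-free spaces and continuous linear maps is monoidal, with $M\circledast N:=(M'\otimes_k N')^*$, unit object $k$, and the coherence isomorphisms that correspond to those of $\otimes_k$ under $M'\otimes_k N'\cong (M\circledast N)'$, $t\mapsto (L\mapsto L(t))$, and $k\cong k'$. For $u\in M$, $v\in N$ let $u\circledast v\in M\circledast N$ be given by $(u\circledast v)(\ell\otimes r)=\ell(u)r(v)$. Let $\mathsf A=(A,\mu\colon A\circledast A\to A,\eta\colon k\to A)$ be a monoid in this monoidal category. Its underlying algebra $UA(\mathsf A)$ is $A$ with the product $uv=\mu(u\circledast v)$ and the unit $\eta(1)$; with the topology of $A$ it is a topological algebra $TA(\mathsf A)$. Its topological dual coalgebra is $A'$ with the comultiplication $A'\xrightarrow{\mu'}(A\circledast A)'\cong A'\otimes_k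 A'$ and the counit $\ell\mapsto \ell(\eta(1))$. For a (not necessarily commutative) unital $k$-algebra $B$, the finite dual coalgebra $B^0$ is the space of the linear functionals on $B$ whose kernel contains a two-sided ideal of finite codimension, with $\delta(f)=\sum_i f_i\otimes g_i$ where $f(ab)=\sum_i f_i(a)g_i(b)$ for all $a,b\in B$, and $\epsilon(f)=f(1)$. The dual algebra of a coalgebra $C$ is $C^*$ with the convolution product. The algebra $B$ is reflexive if $u\mapsto(\ell\mapsto\ell(u))$ is an isomorphism of algebras $B\to (B^0)^*$, and the coalgebra $C$ is coreflexive if $c\mapsto(\ell\mapsto\ell(c))$ is an isomorphism of coalgebras $C\to (C^*)^0$. **Theorem.** The topological dual coalgebra $A'$ of $\mathsf A$ is a subcoalgebra of the finite dual coalgebra $UA(\mathsf A)^0$: every continuous linear functional on $A$ lies in $UA(\mathsf A)^0$, and the inclusion is a morphism of coalgebras. Moreover, the following are equivalent: 1. in $TA(\mathsf A)$ every two-sided ideal of finite codimension is closed; 2. the algebra $UA(\mathsf A)$ is reflexive; 3. the coalgebra $A'$ is coreflexive; 4. $A'=UA(\mathsf A)^0$ as coalgebras. -/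

import Mathlib

open CategoryTheory MonoidalCategory TensorProduct

universe u v w

noncomputable section

namespace FinDual

section Pairing

variable {k : Type u} [Field k]

theorem dualDistrib_injective (M : Type v) (N : Type w) [AddCommGroup M] [Module k M]
    [AddCommGroup N] [Module k N] :
    Function.Injective (TensorProduct.dualDistrib k M N) := by
  rw [injective_iff_map_eq_zero]
  intro t ht
  let b := Module.Free.chooseBasis k (Module.Dual k N)
  apply (TensorProduct.equivFinsuppOfBasisRight b).injective
  rw [map_zero]
  ext i m
  have key : ∀ t : Module.Dual k M ⊗[k] Module.Dual k N, ∀ n,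
      TensorProduct.dualDistrib k M N t (m ⊗ₜ n) =
        Finsupp.linearCombination k (⇑b)
          ((TensorProduct.equivFinsuppOfBasisRight b t).mapRange (fun f => f m) rfl) n := by
    intro t n
    induction t with
    | zero => simp
    | add x y hx hy =>
      rw [map_add, LinearMap.add_apply, hx, hy, map_add,
        Finsupp.mapRange_add (by simp), map_add, LinearMap.add_apply]
    | tmul f g =>
      have : (TensorProduct.equivFinsuppOfBasisRight b (f ⊗ₜ g)).mapRange (fun f => f m) rfl
          = f m • b.repr g := by
        ext j
        simp [mul_comm]
      rw [this, map_smul, Module.Basis.linearCombination_repr]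
      simp
  have h0 : Finsupp.linearCombination k (⇑b)
      ((TensorProduct.equivFinsuppOfBasisRight b t).mapRange (fun f => f m) rfl) = 0 := by
    ext n
    rw [← key, ht]
    rfl
  have h1 := b.linearIndependent
  rw [linearIndependent_iff] at h1
  have := DFunLike.congr_fun (h1 _ h0) i
  simpa using this

/-- For `p : V → B^*` and `q : W → C^*`, the map `V ⊗ W → (B ⊗ C)^*` given by
`(f ⊗ g)(a ⊗ b) = p f a * q g b`. -/
def pairTensor {V W B C : Type*} [AddCommGroup V] [Module k V] [AddCommGroup W] [Module k W]
    [AddCommGroup B] [Module k B] [AddCommGroup C] [Module k C]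
    (p : V →ₗ[k] Module.Dual k B) (q : W →ₗ[k] Module.Dual k C) :
    V ⊗[k] W →ₗ[k] Module.Dual k (B ⊗[k] C) :=
  TensorProduct.dualDistrib k B C ∘ₗ TensorProduct.map p q

section
variable {V W B C : Type*} [AddCommGroup V] [Module k V] [AddCommGroup W] [Module k W]
    [AddCommGroup B] [Module k B] [AddCommGroup C] [Module k C]

@[simp]
theorem pairTensor_tmul (p : V →ₗ[k] Module.Dual k B) (q : W →ₗ[k] Module.Dual k C)
    (f : V) (g : W) (a : B) (b : C) :
    pairTensor p q (f ⊗ₜ g) (a ⊗ₜ b) = p f a * q g b := by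
  simp [pairTensor]

theorem pairTensor_injective {p : V →ₗ[k] Module.Dual k B} {q : W →ₗ[k] Module.Dual k C}
    (hp : Function.Injective p) (hq : Function.Injective q) :
    Function.Injective (pairTensor p q) := by
  unfold pairTensor
  rw [LinearMap.coe_comp]
  exact (dualDistrib_injective B C).comp
    (TensorProduct.map_injective_of_flat_flat p q hp hq)

end

/-- A space `V` of functionals on an algebra `B` is a coalgebra if `δ f = ∑ fᵢ ⊗ gᵢ` with
`f (a * b) = ∑ fᵢ a * gᵢ b`, and `ε f = f 1`. -/
@[reducible]
def coalgebraOfPairing {V B : Type*} [AddCommGroup V] [Module k V] [Ring B] [Algebra k B]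
    (p : V →ₗ[k] Module.Dual k B) (hp : Function.Injective p)
    (δ : V →ₗ[k] V ⊗[k] V) (ε : V →ₗ[k] k)
    (hδ : ∀ f a b, pairTensor p p (δ f) (a ⊗ₜ b) = p f (a * b))
    (hε : ∀ f, ε f = p f 1) : Coalgebra k V where
  comul := δ
  counit := ε
  coassoc := by
    ext f
    apply pairTensor_injective hp (pairTensor_injective hp hp)
    have hL : ∀ (t : V ⊗[k] V) a b c,
        pairTensor p (pairTensor p p) (δ.lTensor V t) (a ⊗ₜ (b ⊗ₜ c))
          = pairTensor p p t (a ⊗ₜ (b * c)) := by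
      intro t a b c
      induction t with
      | zero => simp
      | add x y hx hy => simp only [map_add, LinearMap.add_apply, hx, hy]
      | tmul x y => simp [hδ]
    have hS : ∀ (s : V ⊗[k] V) g a b c,
        pairTensor p (pairTensor p p) (TensorProduct.assoc k V V V (s ⊗ₜ g)) (a ⊗ₜ (b ⊗ₜ c))
          = pairTensor p p s (a ⊗ₜ b) * p g c := by
      intro s g a b c
      induction s with
      | zero => simp
      | add x y hx hy =>
        simp only [TensorProduct.add_tmul, map_add, LinearMap.add_apply, hx, hy, add_mul]
      | tmul x y => simp [mul_assoc]
    have hR : ∀ (t : V ⊗[k] V) a b c,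
        pairTensor p (pairTensor p p) (TensorProduct.assoc k V V V (δ.rTensor V t))
          (a ⊗ₜ (b ⊗ₜ c)) = pairTensor p p t ((a * b) ⊗ₜ c) := by
      intro t a b c
      induction t with
      | zero => simp
      | add x y hx hy => simp only [map_add, LinearMap.add_apply, hx, hy]
      | tmul x y => rw [LinearMap.rTensor_tmul, hS, hδ, pairTensor_tmul]
    apply TensorProduct.ext'
    intro a bc
    induction bc with
    | zero => simp
    | add x y hx hy => rw [TensorProduct.tmul_add, map_add, map_add, hx, hy]
    | tmul b c =>
      simp only [LinearMap.comp_apply, LinearEquiv.coe_coe]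
      rw [hL, hR, hδ, hδ, mul_assoc]
  rTensor_counit_comp_comul := by
    ext f
    apply (TensorProduct.lid k V).injective
    apply hp
    ext b
    have h : ∀ t : V ⊗[k] V, p (TensorProduct.lid k V (ε.rTensor V t)) b
        = pairTensor p p t (1 ⊗ₜ b) := by
      intro t
      induction t with
      | zero => simp
      | add x y hx hy => simp only [map_add, LinearMap.add_apply, hx, hy]
      | tmul x y => simp [hε]
    simp [h, hδ]
  lTensor_counit_comp_comul := by
    ext f
    apply (TensorProduct.rid k V).injective
    apply hp
    ext b
    have h : ∀ t : V ⊗[k] V, p (TensorProduct.rid k V (ε.lTensor V t)) b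
        = pairTensor p p t (b ⊗ₜ 1) := by
      intro t
      induction t with
      | zero => simp
      | add x y hx hy => simp only [map_add, LinearMap.add_apply, hx, hy]
      | tmul x y => simp [hε, mul_comm]
    simp [h, hδ]

end Pairing

section FiniteDual

variable (k : Type u) [Field k] (B : Type v) [Ring B] [Algebra k B]

/-- The underlying space `B⁰` of the finite dual: the linear functionals on `B` whose kernel
contains a two-sided ideal of finite codimension. -/
def finiteDual : Submodule k (Module.Dual k B) where
  carrier := {f | ∃ I : Ideal B, I.IsTwoSided ∧ Module.Finite k (B ⧸ I) ∧ ∀ x ∈ I, f x = 0}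
  zero_mem' := by
    refine ⟨⊤, inferInstance, ?_, fun _ _ => rfl⟩
    infer_instance
  add_mem' := by
    rintro f g ⟨I, hI, hIf, hf⟩ ⟨J, hJ, hJf, hg⟩
    refine ⟨I ⊓ J, ⟨fun b hx => ⟨I.mul_mem_right b hx.1, J.mul_mem_right b hx.2⟩⟩, ?_,
      fun x hx => ?_⟩
    · let φ : B →ₗ[k] (B ⧸ I) × (B ⧸ J) :=
        (I.mkQ.restrictScalars k).prod (J.mkQ.restrictScalars k)
      have hφ : LinearMap.ker φ = (I ⊓ J).restrictScalars k := by
        ext x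
        simp [φ]
      have h1 : Module.Finite k (B ⧸ LinearMap.ker φ) :=
        Module.Finite.equiv φ.quotKerEquivRange.symm
      rw [hφ] at h1
      exact h1
    · rw [LinearMap.add_apply, hf x hx.1, hg x hx.2, add_zero]
  smul_mem' := by
    rintro c f ⟨I, hI, hIf, hf⟩
    exact ⟨I, hI, hIf, fun x hx => by rw [LinearMap.smul_apply, hf x hx, smul_zero]⟩

theorem finiteDual_subtype_injective : Function.Injective (finiteDual k B).subtype :=
  Subtype.val_injective

/-- The canonical injection `B⁰ ⊗ B⁰ → (B ⊗ B)^*`. -/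
def finiteDualPair : finiteDual k B ⊗[k] finiteDual k B →ₗ[k] Module.Dual k (B ⊗[k] B) :=
  pairTensor (V := finiteDual k B) (W := finiteDual k B)
    (finiteDual k B).subtype (finiteDual k B).subtype

theorem finiteDualPair_injective : Function.Injective (finiteDualPair k B) :=
  pairTensor_injective (V := finiteDual k B) (W := finiteDual k B)
    (finiteDual_subtype_injective k B) (finiteDual_subtype_injective k B)

variable {k B}

theorem finiteDual_mul_mem (f : finiteDual k B) :
    (f : Module.Dual k B) ∘ₗ LinearMap.mul' k B ∈ LinearMap.range (finiteDualPair k B) := by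
  obtain ⟨f, I, hI, hIf, hf⟩ := f
  let Q := B ⧸ I
  let π : B →ₐ[k] Q := Ideal.Quotient.mkₐ k I
  have hfQ : ∃ g : Module.Dual k Q, ∀ x, g (π x) = f x :=
    ⟨(I.restrictScalars k).liftQ f (fun x hx => by simpa using hf x hx), fun x => rfl⟩
  obtain ⟨g, hg⟩ := hfQ
  let j : Module.Dual k Q →ₗ[k] finiteDual k B :=
    (Module.Dual.transpose (R := k) π.toLinearMap).codRestrict (finiteDual k B)
      (fun h => ⟨I, hI, hIf, fun x hx => by
        have : π x = 0 := Ideal.Quotient.eq_zero_iff_mem.mpr hx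
        simp [Module.Dual.transpose_apply, this]⟩)
  let t := (TensorProduct.dualDistribEquiv k Q Q).symm (g ∘ₗ LinearMap.mul' k Q)
  have ht : TensorProduct.dualDistrib k Q Q t = g ∘ₗ LinearMap.mul' k Q :=
    (TensorProduct.dualDistribEquiv k Q Q).apply_symm_apply _
  refine ⟨TensorProduct.map j j t, ?_⟩
  have key : ∀ (t : Module.Dual k Q ⊗[k] Module.Dual k Q) a b,
      finiteDualPair k B (TensorProduct.map j j t) (a ⊗ₜ b) = TensorProduct.dualDistrib k Q Q t (π a ⊗ₜ π b) := by
    intro t a b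
    induction t with
    | zero => simp
    | add x y hx hy => simp only [map_add, LinearMap.add_apply, hx, hy]
    | tmul x y =>
      simp only [TensorProduct.map_tmul, finiteDualPair, pairTensor_tmul,
        TensorProduct.dualDistrib_apply]
      rfl
  apply TensorProduct.ext'
  intro a b
  rw [key, ht]
  simp [← map_mul, hg]

variable (k B)

/-- The map `B⁰ → (B ⊗ B)^*`, `f ↦ f ∘ m`, seen as a map into the range of the canonical
injection of `B⁰ ⊗ B⁰`. -/
def finiteDualMul : finiteDual k B →ₗ[k] LinearMap.range (finiteDualPair k B) :=
  ((Module.Dual.transpose (R := k) (LinearMap.mul' k B)) ∘ₗ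
    (finiteDual k B).subtype).codRestrict _ finiteDual_mul_mem

/-- The comultiplication of the finite dual: `f ↦ ∑ fᵢ ⊗ gᵢ` with `f (a * b) = ∑ fᵢ a * gᵢ b`. -/
def finiteDualComul : finiteDual k B →ₗ[k] finiteDual k B ⊗[k] finiteDual k B :=
  (LinearEquiv.ofInjective _ (finiteDualPair_injective k B)).symm.toLinearMap ∘ₗ
    finiteDualMul k B

/-- The finite dual coalgebra `D_fin(B)`, with counit `f ↦ f 1`. -/
instance finiteDualCoalgebra : Coalgebra k (finiteDual k B) :=
  coalgebraOfPairing (V := finiteDual k B) (finiteDual k B).subtype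
    (finiteDual_subtype_injective k B) (finiteDualComul k B)
    (LinearMap.applyₗ (1 : B) ∘ₗ (finiteDual k B).subtype)
    (fun f a b => by
      have h := LinearEquiv.apply_symm_apply
        (LinearEquiv.ofInjective _ (finiteDualPair_injective k B)) (finiteDualMul k B f)
      exact LinearMap.congr_fun (congrArg Subtype.val h) (a ⊗ₜ b))
    (fun f => rfl)

/-- An algebra `B` is reflexive if `u ↦ (ℓ ↦ ℓ u)` is an isomorphism of algebras from `B` onto
the dual algebra (with the convolution product) of its finite dual coalgebra. -/
def IsReflexive : Prop :=
  ∃ e : B ≃ₐ[k] WithConv (finiteDual k B →ₗ[k] k),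
    ∀ (u : B) (ℓ : finiteDual k B), (e u).ofConv ℓ = (ℓ : Module.Dual k B) u

/-- A coalgebra `C` is coreflexive if `c ↦ (ℓ ↦ ℓ c)` is an isomorphism of coalgebras from `C`
onto the finite dual coalgebra of its dual algebra (with the convolution product). -/
def IsCoreflexive (C : Type w) [AddCommGroup C] [Module k C] [Coalgebra k C] : Prop :=
  ∃ e : C ≃ₗc[k] finiteDual k (WithConv (C →ₗ[k] k)),
    ∀ (c : C) (ℓ : WithConv (C →ₗ[k] k)),
      (e c : Module.Dual k (WithConv (C →ₗ[k] k))) ℓ = ℓ.ofConv c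

end FiniteDual

end FinDual

namespace TopFree

open FinDual

section Duals

set_option linter.unusedSectionVars false

variable (k : Type u) [Field k] [TopologicalSpace k] [DiscreteTopology k]

/-- The algebraic dual `V^*` with the weak-`*` topology, i.e. the initial topology induced by the
evaluations at the points of `V`. -/
def WeakStar (V : Type v) [AddCommGroup V] [Module k V] : Type (max u v) :=
  Module.Dual k V

variable {k}

instance (V : Type v) [AddCommGroup V] [Module k V] : AddCommGroup (WeakStar k V) :=
  inferInstanceAs (AddCommGroup (Module.Dual k V))

instance (V : Type v) [AddCommGroup V] [Module k V] : Module k (WeakStar k V) :=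
  inferInstanceAs (Module k (Module.Dual k V))

/-- `V^*` with and without the topology. -/
def WeakStar.toDual (V : Type v) [AddCommGroup V] [Module k V] :
    WeakStar k V ≃ₗ[k] Module.Dual k V :=
  LinearEquiv.refl k (Module.Dual k V)

instance (V : Type v) [AddCommGroup V] [Module k V] : TopologicalSpace (WeakStar k V) :=
  TopologicalSpace.induced (fun L v => WeakStar.toDual V L v) Pi.topologicalSpace

/-- The inclusion of `V^*` in the power `k^V`. -/
def WeakStar.toFun (V : Type v) [AddCommGroup V] [Module k V] : WeakStar k V →ₗ[k] (V → k) where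
  toFun L v := WeakStar.toDual V L v
  map_add' _ _ := rfl
  map_smul' _ _ := rfl

instance (V : Type v) [AddCommGroup V] [Module k V] : IsTopologicalAddGroup (WeakStar k V) :=
  topologicalAddGroup_induced (WeakStar.toFun V)

instance (V : Type v) [AddCommGroup V] [Module k V] : ContinuousSMul k (WeakStar k V) :=
  continuousSMul_induced (WeakStar.toFun V)

section
variable {V : Type v} [AddCommGroup V] [Module k V] {W : Type w} [AddCommGroup W] [Module k W]

theorem WeakStar.continuous_eval (v : V) :
    Continuous fun L : WeakStar k V => WeakStar.toDual V L v :=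
  (continuous_apply v).comp continuous_induced_dom

theorem WeakStar.continuous_of_eval {α : Type*} [TopologicalSpace α] {g : α → WeakStar k V}
    (h : ∀ v, Continuous fun a => WeakStar.toDual V (g a) v) : Continuous g :=
  continuous_induced_rng.2 (continuous_pi h)

/-- The transpose `f^* : W^* → V^*`, `ℓ ↦ ℓ ∘ f`. -/
def algMap (f : V →ₗ[k] W) : WeakStar k W →L[k] WeakStar k V where
  toLinearMap := (WeakStar.toDual V).symm.toLinearMap ∘ₗ Module.Dual.transpose (R := k) f ∘ₗ
    (WeakStar.toDual W).toLinearMap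
  cont := WeakStar.continuous_of_eval fun v => WeakStar.continuous_eval (f v)

@[simp]
theorem toDual_algMap (f : V →ₗ[k] W) (L : WeakStar k W) (v : V) :
    WeakStar.toDual V (algMap f L) v = WeakStar.toDual W L (f v) := rfl

theorem WeakStar.ext {L L' : WeakStar k V}
    (h : ∀ v, WeakStar.toDual V L v = WeakStar.toDual V L' v) : L = L' :=
  (WeakStar.toDual V).injective (LinearMap.ext h)

/-- An isomorphism `V ≃ W` induces an isomorphism `W^* ≃ V^*`. -/
def algEquiv (e : V ≃ₗ[k] W) : WeakStar k W ≃L[k] WeakStar k V :=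
  ContinuousLinearEquiv.equivOfInverse (algMap e.toLinearMap) (algMap e.symm.toLinearMap)
    (fun L => WeakStar.ext fun v => by simp) (fun L => WeakStar.ext fun v => by simp)

@[simp]
theorem toDual_algEquiv (e : V ≃ₗ[k] W) (L : WeakStar k W) (v : V) :
    WeakStar.toDual V (algEquiv e L) v = WeakStar.toDual W L (e v) := rfl

@[simp]
theorem toDual_algEquiv_symm (e : V ≃ₗ[k] W) (L : WeakStar k V) (w : W) :
    WeakStar.toDual W ((algEquiv e).symm L) w = WeakStar.toDual V L (e.symm w) := rfl

/-- A topological vector space is topologically-free if it is isomorphic to a power of `k`. -/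
def IsTopFree (k : Type u) [Field k] [TopologicalSpace k] (E : Type v) [AddCommGroup E]
    [Module k E] [TopologicalSpace E] : Prop :=
  ∃ X : Type v, Nonempty (E ≃L[k] (X → k))

/-- The evaluation map `Λ_V : V → (V^*)'`, `v ↦ (ℓ ↦ ℓ v)`. -/
def lambda (V : Type v) [AddCommGroup V] [Module k V] : V →ₗ[k] StrongDual k (WeakStar k V) where
  toFun v := ⟨LinearMap.applyₗ v ∘ₗ (WeakStar.toDual V).toLinearMap,
    WeakStar.continuous_eval v⟩
  map_add' v w := ContinuousLinearMap.ext fun L => map_add (WeakStar.toDual V L) v w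
  map_smul' c v := ContinuousLinearMap.ext fun L => map_smul (WeakStar.toDual V L) c v

@[simp]
theorem lambda_apply (v : V) (L : WeakStar k V) : lambda V v L = WeakStar.toDual V L v := rfl

theorem lambda_injective : Function.Injective (lambda (k := k) V) := by
  rw [injective_iff_map_eq_zero]
  intro v hv
  rw [← Module.forall_dual_apply_eq_zero_iff k]
  intro φ
  exact DFunLike.congr_fun hv ((WeakStar.toDual V).symm φ)

theorem lambda_surjective : Function.Surjective (lambda (k := k) V) := by
  intro ℓ
  have h0 : IsOpen (ℓ ⁻¹' {0}) := (isOpen_discrete _).preimage ℓ.continuous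
  obtain ⟨U, hU, hUe⟩ := isOpen_induced_iff.mp h0
  have hmem : (fun v => WeakStar.toDual V (0 : WeakStar k V) v) ∈ U := by
    have : (0 : WeakStar k V) ∈ ℓ ⁻¹' {0} := by simp
    rw [← hUe] at this
    exact this
  obtain ⟨s, t, hs, hst⟩ := isOpen_pi_iff.mp hU _ hmem
  have hker : ∀ L : WeakStar k V, (∀ v ∈ s, WeakStar.toDual V L v = 0) → ℓ L = 0 := by
    intro L hL
    have : L ∈ ℓ ⁻¹' {0} := by
      rw [← hUe]
      apply hst
      intro v hv
      have := (hs v hv).2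
      simp only [map_zero, LinearMap.zero_apply] at this
      change WeakStar.toDual V L v ∈ t v
      rw [hL v hv]
      exact this
    exact this
  have hk : ⨅ v : s, LinearMap.ker (lambda (k := k) V v.1).toLinearMap ≤
      LinearMap.ker ℓ.toLinearMap := by
    intro L hL
    simp only [Submodule.mem_iInf] at hL
    exact hker L fun v hv => hL ⟨v, hv⟩
  have hspan := mem_span_of_iInf_ker_le_ker hk
  have hle : Submodule.span k (Set.range fun v : s => (lambda (k := k) V v.1).toLinearMap) ≤
      LinearMap.range ((ContinuousLinearMap.coeLM k) ∘ₗ lambda (k := k) V) := by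
    rw [Submodule.span_le]
    rintro _ ⟨v, rfl⟩
    exact ⟨v.1, rfl⟩
  obtain ⟨v, hv⟩ := hle hspan
  exact ⟨v, ContinuousLinearMap.coe_injective hv⟩

/-- `Λ_V : V ≃ (V^*)'`. -/
def lambdaEquiv (V : Type v) [AddCommGroup V] [Module k V] :
    V ≃ₗ[k] StrongDual k (WeakStar k V) :=
  LinearEquiv.ofBijective (lambda V) ⟨lambda_injective, lambda_surjective⟩

@[simp]
theorem lambdaEquiv_apply (v : V) (L : WeakStar k V) :
    lambdaEquiv V v L = WeakStar.toDual V L v := rfl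

@[simp]
theorem toDual_lambdaEquiv_symm (ℓ : StrongDual k (WeakStar k V)) (L : WeakStar k V) :
    WeakStar.toDual V L ((lambdaEquiv V).symm ℓ) = ℓ L := by
  rw [← lambdaEquiv_apply, LinearEquiv.apply_symm_apply]

end

theorem isTopFree_weakStar {V : Type u} [AddCommGroup V] [Module k V] :
    IsTopFree k (WeakStar k V) := by
  let b := Module.Basis.ofVectorSpace k V
  refine ⟨Module.Basis.ofVectorSpaceIndex k V,
    ⟨{ toLinearEquiv := (WeakStar.toDual V).trans (b.constr k).symm
       continuous_toFun := ?_
       continuous_invFun := ?_ }⟩⟩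
  · apply continuous_pi
    intro i
    exact WeakStar.continuous_eval (b i)
  · apply WeakStar.continuous_of_eval
    intro v
    have : (fun a : Module.Basis.ofVectorSpaceIndex k V → k =>
        WeakStar.toDual V (((WeakStar.toDual V).trans (b.constr k).symm).symm a) v)
        = fun a => (b.repr v).sum fun i c => c • a i := by
      ext a
      exact Module.Basis.constr_apply b k a v
    change Continuous (fun a : Module.Basis.ofVectorSpaceIndex k V → k =>
        WeakStar.toDual V (((WeakStar.toDual V).trans (b.constr k).symm).symm a) v)
    rw [this]
    unfold Finsupp.sum
    fun_prop

section

variable {E : Type v} [AddCommGroup E] [Module k E] [TopologicalSpace E]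
variable {F : Type w} [AddCommGroup F] [Module k F] [TopologicalSpace F]

/-- The transpose `f' : F' → E'`, `ℓ ↦ ℓ ∘ f`, on topological duals. -/
def topMap (f : E →L[k] F) : StrongDual k F →ₗ[k] StrongDual k E where
  toFun ℓ := ℓ.comp f
  map_add' _ _ := rfl
  map_smul' _ _ := rfl

@[simp]
theorem topMap_apply (f : E →L[k] F) (ℓ : StrongDual k F) (u : E) : topMap f ℓ u = ℓ (f u) := rfl

/-- The evaluation map `Γ_E : E → (E')^*`, `u ↦ (ℓ ↦ ℓ u)`. -/
def gamma (E : Type v) [AddCommGroup E] [Module k E] [TopologicalSpace E] :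
    E →L[k] WeakStar k (StrongDual k E) where
  toFun u := (WeakStar.toDual (StrongDual k E)).symm
    (LinearMap.applyₗ u ∘ₗ ContinuousLinearMap.coeLM k)
  map_add' u v := WeakStar.ext fun ℓ => by simp
  map_smul' c u := WeakStar.ext fun ℓ => by simp
  cont := WeakStar.continuous_of_eval fun ℓ => ℓ.continuous

@[simp]
theorem toDual_gamma (u : E) (ℓ : StrongDual k E) :
    WeakStar.toDual (StrongDual k E) (gamma E u) ℓ = ℓ u := rfl

theorem gamma_injective (hE : IsTopFree k E) : Function.Injective (gamma (k := k) E) := by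
  obtain ⟨X, ⟨θ⟩⟩ := hE
  intro u v huv
  apply θ.injective
  ext x
  exact DFunLike.congr_fun (congrArg (WeakStar.toDual (StrongDual k E)) huv)
    ((ContinuousLinearMap.proj x).comp θ.toContinuousLinearMap)

theorem IsTopFree.ext (hE : IsTopFree k E) {u v : E} (h : ∀ ℓ : StrongDual k E, ℓ u = ℓ v) :
    u = v :=
  gamma_injective hE (WeakStar.ext h)

/-- `Γ_E` is an isomorphism for a topologically-free `E`. -/
theorem exists_gamma_inverse (hE : IsTopFree k E) :
    ∃ g : WeakStar k (StrongDual k E) →L[k] E, Function.LeftInverse g (gamma E) ∧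
      Function.RightInverse g (gamma E) := by
  obtain ⟨X, ⟨θ⟩⟩ := id hE
  let π : X → StrongDual k E := fun x =>
    (ContinuousLinearMap.proj x).comp θ.toContinuousLinearMap
  let g : WeakStar k (StrongDual k E) →L[k] E := θ.symm.toContinuousLinearMap.comp
    (ContinuousLinearMap.pi fun x => lambda (StrongDual k E) (π x))
  have hπ : ∀ L x, π x (g L) = WeakStar.toDual _ L (π x) := by
    intro L x
    simp [π, g]
  have hl : Function.LeftInverse g (gamma E) := by
    intro u
    apply θ.injective
    ext x
    exact hπ (gamma E u) x
  refine ⟨g, hl, fun L => WeakStar.ext fun ℓ => ?_⟩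
  -- a continuous functional on a power of `k` depends on finitely many coordinates
  let m : StrongDual k (X → k) := ℓ.comp θ.symm.toContinuousLinearMap
  have h0 : IsOpen (m ⁻¹' {0}) := (isOpen_discrete _).preimage m.continuous
  obtain ⟨s, t, hs, hst⟩ := isOpen_pi_iff.mp h0 0 (by simp)
  have hker : ∀ f : X → k, (∀ x ∈ s, f x = 0) → m f = 0 := by
    intro f hf
    apply hst
    intro x hx
    rw [hf x hx]
    exact (hs x hx).2
  have hspan := mem_span_of_iInf_ker_le_ker
    (L := fun x : s => (π x.1).toLinearMap) (K := ℓ.toLinearMap) (by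
      intro u hu
      simp only [Submodule.mem_iInf, LinearMap.mem_ker] at hu ⊢
      have := hker (θ u) fun x hx => hu ⟨x, hx⟩
      simpa [m] using this)
  have hle : Submodule.span k (Set.range fun x : s => (π x.1).toLinearMap) ≤
      (Submodule.span k (Set.range π)).map (ContinuousLinearMap.coeLM k) := by
    rw [Submodule.span_le]
    rintro _ ⟨x, rfl⟩
    exact ⟨π x.1, Submodule.subset_span ⟨x.1, rfl⟩, rfl⟩
  obtain ⟨ℓ', hℓ', he⟩ := hle hspan
  obtain rfl : ℓ' = ℓ := ContinuousLinearMap.coe_injective he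
  rw [toDual_gamma]
  clear he hspan hker hs hst m h0
  induction hℓ' using Submodule.span_induction with
  | mem y hy =>
    obtain ⟨x, rfl⟩ := hy
    exact hπ L x
  | zero => simp
  | add y z _ _ hy hz => simp [hy, hz]
  | smul c y _ hy => simp [hy]

/-- `Γ_E : E ≃ (E')^*` for a topologically-free `E`. -/
def gammaEquiv (hE : IsTopFree k E) : E ≃L[k] WeakStar k (StrongDual k E) :=
  ContinuousLinearEquiv.equivOfInverse (gamma E) (exists_gamma_inverse hE).choose
    (exists_gamma_inverse hE).choose_spec.1 (exists_gamma_inverse hE).choose_spec.2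

@[simp]
theorem toDual_gammaEquiv (hE : IsTopFree k E) (u : E) (ℓ : StrongDual k E) :
    WeakStar.toDual (StrongDual k E) (gammaEquiv hE u) ℓ = ℓ u := rfl

@[simp]
theorem apply_gammaEquiv_symm (hE : IsTopFree k E) (L : WeakStar k (StrongDual k E))
    (ℓ : StrongDual k E) :
    ℓ ((gammaEquiv hE).symm L) = WeakStar.toDual (StrongDual k E) L ℓ := by
  rw [← toDual_gammaEquiv hE, ContinuousLinearEquiv.apply_symm_apply]

variable (E F) in
/-- The topological tensor product `E ⊛ F = ((E' ⊗ F')^*, w^*)`. -/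
abbrev TopTensor : Type (max u v w) := WeakStar k (StrongDual k E ⊗[k] StrongDual k F)

end

end Duals

section Category

set_option linter.unusedSectionVars false

variable (k : Type u) [Field k] [TopologicalSpace k] [DiscreteTopology k]

/-- The category of topologically-free `k`-vector spaces, a full subcategory of the category of
topological `k`-vector spaces. -/
abbrev TopFreeVect : Type (u + 1) :=
  ObjectProperty.FullSubcategory (C := TopModuleCat.{u} k) fun M => IsTopFree k M

variable {k}

/-- The continuous linear map underlying a morphism. -/
abbrev clm {M N : TopFreeVect k} (f : M ⟶ N) : M.obj →L[k] N.obj :=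
  TopModuleCat.Hom.hom f.hom

/-- The morphism given by a continuous linear map. -/
abbrev ofClm {M N : TopFreeVect k} (f : M.obj →L[k] N.obj) : M ⟶ N :=
  ObjectProperty.homMk (ConcreteCategory.ofHom f)

/-- The isomorphism given by a continuous linear equivalence. -/
abbrev isoOfClm {M N : TopFreeVect k} (e : M.obj ≃L[k] N.obj) : M ≅ N :=
  ObjectProperty.isoMk _ (TopModuleCat.ofIso e)

/-- The object `Alg(V) = (V^*, w^*)`. -/
abbrev algObj (V : Type u) [AddCommGroup V] [Module k V] : TopFreeVect k :=
  ⟨TopModuleCat.of k (WeakStar k V), isTopFree_weakStar⟩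

theorem isTopFree_self : IsTopFree k k :=
  ⟨PUnit, ⟨(ContinuousLinearEquiv.funUnique PUnit k k).symm⟩⟩

variable (k) in
/-- The topological dual functor `Top`. -/
def topFunctor : TopFreeVect k ⥤ (ModuleCat.{u} k)ᵒᵖ where
  obj M := Opposite.op (ModuleCat.of k (StrongDual k M.obj))
  map f := (ModuleCat.ofHom (topMap (clm f))).op

instance : (topFunctor k).Faithful where
  map_injective {M N f g} h := by
    apply ObjectProperty.hom_ext
    apply ConcreteCategory.hom_ext
    intro u
    apply IsTopFree.ext N.property
    intro ℓ
    have h1 : topMap (clm f) = topMap (clm g) :=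
      congrArg (fun t : (topFunctor k).obj M ⟶ (topFunctor k).obj N =>
        ModuleCat.Hom.hom t.unop) h
    exact DFunLike.congr_fun (LinearMap.congr_fun h1 ℓ) u

/-- The isomorphism `ψ : k ≃ k'` which maps `1` to the identity. -/
def unitDual : k ≃ₗ[k] StrongDual k k :=
  LinearEquiv.ofLinearMap
    { toFun := fun c => c • ContinuousLinearMap.id k k
      map_add' := fun a b => add_smul a b _
      map_smul' := fun a b => mul_smul a b _ }
    { toFun := fun ℓ => ℓ 1
      map_add' := fun _ _ => rfl
      map_smul' := fun _ _ => rfl }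
    (by ext ℓ; simp) (by ext; simp)

@[simp] theorem unitDual_apply (c a : k) : unitDual (k := k) c a = c * a := rfl

@[simp] theorem unitDual_symm_apply (ℓ : StrongDual k k) : unitDual.symm ℓ = ℓ 1 := rfl

/-- The topological tensor product `M ⊛ N = ((M' ⊗ N')^*, w^*)`. -/
abbrev tensorObj' (M N : TopFreeVect k) : TopFreeVect k :=
  algObj (StrongDual k M.obj ⊗[k] StrongDual k N.obj)

/-- The isomorphism `Ψ = Λ_{M' ⊗ N'} : M' ⊗ N' ≃ (M ⊛ N)'`. -/
def psi (M N : TopFreeVect k) :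
    StrongDual k M.obj ⊗[k] StrongDual k N.obj ≃ₗ[k] StrongDual k (tensorObj' M N).obj :=
  lambdaEquiv (StrongDual k M.obj ⊗[k] StrongDual k N.obj)

/-- `f' ⊗ g'`. -/
def tensorMapDual {M N P Q : TopFreeVect k} (f : M.obj →L[k] N.obj) (g : P.obj →L[k] Q.obj) :
    StrongDual k N.obj ⊗[k] StrongDual k Q.obj →ₗ[k]
      StrongDual k M.obj ⊗[k] StrongDual k P.obj :=
  TensorProduct.map (topMap f) (topMap g)

/-- `f ⊛ g = (f' ⊗ g')^*`. -/
def tensorMap {M N P Q : TopFreeVect k} (f : M.obj →L[k] N.obj) (g : P.obj →L[k] Q.obj) :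
    (tensorObj' M P).obj →L[k] (tensorObj' N Q).obj :=
  algMap (k := k) (V := StrongDual k N.obj ⊗[k] StrongDual k Q.obj)
    (W := StrongDual k M.obj ⊗[k] StrongDual k P.obj) (tensorMapDual f g)

/-- `M' ⊗ (N ⊛ P)' ≃ M' ⊗ (N' ⊗ P') ≃ (M' ⊗ N') ⊗ P' ≃ (M ⊛ N)' ⊗ P'`. -/
def assocDual (M N P : TopFreeVect k) :
    StrongDual k M.obj ⊗[k] StrongDual k (tensorObj' N P).obj ≃ₗ[k]
      StrongDual k (tensorObj' M N).obj ⊗[k] StrongDual k P.obj :=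
  (TensorProduct.congr (LinearEquiv.refl k _) (psi N P).symm).trans
    ((TensorProduct.assoc k _ _ _).symm.trans
      (TensorProduct.congr (psi M N) (LinearEquiv.refl k _)))

/-- The associativity isomorphism `(M ⊛ N) ⊛ P ≃ M ⊛ (N ⊛ P)`. -/
def assocEquiv (M N P : TopFreeVect k) :
    (tensorObj' (tensorObj' M N) P).obj ≃L[k] (tensorObj' M (tensorObj' N P)).obj :=
  algEquiv (k := k) (V := StrongDual k M.obj ⊗[k] StrongDual k (tensorObj' N P).obj)
    (W := StrongDual k (tensorObj' M N).obj ⊗[k] StrongDual k P.obj) (assocDual M N P)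

/-- The unit object `(k, d)`. -/
abbrev unitObj : TopFreeVect k := ⟨TopModuleCat.of k k, isTopFree_self⟩

/-- `M' ≃ k' ⊗ M'`, `ℓ ↦ id ⊗ ℓ`. -/
def leftUnitDual (M : TopFreeVect k) :
    StrongDual k M.obj ≃ₗ[k] StrongDual k (unitObj (k := k)).obj ⊗[k] StrongDual k M.obj :=
  (TensorProduct.lid k _).symm.trans (TensorProduct.congr unitDual (LinearEquiv.refl k _))

/-- `M' ≃ M' ⊗ k'`, `ℓ ↦ ℓ ⊗ id`. -/
def rightUnitDual (M : TopFreeVect k) :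
    StrongDual k M.obj ≃ₗ[k] StrongDual k M.obj ⊗[k] StrongDual k (unitObj (k := k)).obj :=
  (TensorProduct.rid k _).symm.trans (TensorProduct.congr (LinearEquiv.refl k _) unitDual)

/-- The left unit isomorphism `k ⊛ M ≃ (M')^* ≃ M`. -/
def leftUnitEquiv (M : TopFreeVect k) : (tensorObj' unitObj M).obj ≃L[k] M.obj :=
  (algEquiv (k := k) (V := StrongDual k M.obj)
    (W := StrongDual k (unitObj (k := k)).obj ⊗[k] StrongDual k M.obj) (leftUnitDual M)).trans (gammaEquiv M.property).symm

/-- The right unit isomorphism `M ⊛ k ≃ (M')^* ≃ M`. -/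
def rightUnitEquiv (M : TopFreeVect k) : (tensorObj' M unitObj).obj ≃L[k] M.obj :=
  (algEquiv (k := k) (V := StrongDual k M.obj)
    (W := StrongDual k M.obj ⊗[k] StrongDual k (unitObj (k := k)).obj) (rightUnitDual M)).trans (gammaEquiv M.property).symm

instance : MonoidalCategoryStruct (TopFreeVect k) where
  tensorObj := tensorObj'
  tensorUnit := unitObj
  tensorHom f g := ofClm (tensorMap (clm f) (clm g))
  whiskerLeft M _ _ f := ofClm (tensorMap (ContinuousLinearMap.id k M.obj) (clm f))
  whiskerRight f M := ofClm (tensorMap (clm f) (ContinuousLinearMap.id k M.obj))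
  associator M N P := isoOfClm (assocEquiv M N P)
  leftUnitor M := isoOfClm (leftUnitEquiv M)
  rightUnitor M := isoOfClm (rightUnitEquiv M)

theorem topMap_tensorMap {M N P Q : TopFreeVect k} (f : M.obj →L[k] N.obj)
    (g : P.obj →L[k] Q.obj) :
    topMap (tensorMap f g) = (psi M P).toLinearMap ∘ₗ
      TensorProduct.map (topMap f) (topMap g) ∘ₗ (psi N Q).symm.toLinearMap := by
  ext ℓ L
  obtain ⟨t, rfl⟩ := (psi N Q).surjective ℓ
  simp only [LinearMap.comp_apply, LinearEquiv.coe_coe, LinearEquiv.symm_apply_apply]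
  rfl

theorem topMap_assocEquiv (M N P : TopFreeVect k) :
    topMap (assocEquiv M N P).toContinuousLinearMap =
      (psi (tensorObj' M N) P).toLinearMap ∘ₗ (assocDual M N P).toLinearMap ∘ₗ
        (psi M (tensorObj' N P)).symm.toLinearMap := by
  ext ℓ L
  obtain ⟨t, rfl⟩ := (psi M (tensorObj' N P)).surjective ℓ
  simp only [LinearMap.comp_apply, LinearEquiv.coe_coe, LinearEquiv.symm_apply_apply]
  rfl

theorem topMap_leftUnitEquiv (M : TopFreeVect k) :
    topMap (leftUnitEquiv M).toContinuousLinearMap =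
      (psi unitObj M).toLinearMap ∘ₗ (leftUnitDual M).toLinearMap := by
  ext ℓ L
  exact apply_gammaEquiv_symm M.property _ ℓ

theorem topMap_rightUnitEquiv (M : TopFreeVect k) :
    topMap (rightUnitEquiv M).toContinuousLinearMap =
      (psi M unitObj).toLinearMap ∘ₗ (rightUnitDual M).toLinearMap := by
  ext ℓ L
  exact apply_gammaEquiv_symm M.property _ ℓ

/-- The topological dual functor, together with `Ψ` and `ψ`, is compatible with the tensor
products, so the coherence of `⊛` follows from that of `⊗`. -/
def topFunctorData : Monoidal.InducingFunctorData (topFunctor k) where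
  μIso M N := (psi M N).toModuleIso.symm.op
  εIso := (unitDual (k := k)).toModuleIso.symm.op
  whiskerLeft_eq M N P f := by
    apply Quiver.Hom.unop_inj
    apply ModuleCat.hom_ext
    exact topMap_tensorMap (ContinuousLinearMap.id k M.obj) (clm f)
  whiskerRight_eq {M N} f P := by
    apply Quiver.Hom.unop_inj
    apply ModuleCat.hom_ext
    exact topMap_tensorMap (clm f) (ContinuousLinearMap.id k P.obj)
  tensorHom_eq f g := by
    apply Quiver.Hom.unop_inj
    apply ModuleCat.hom_ext
    exact topMap_tensorMap (clm f) (clm g)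
  associator_eq M N P := by
    apply Quiver.Hom.unop_inj
    apply ModuleCat.hom_ext
    refine (topMap_assocEquiv M N P).trans ?_
    rfl
  leftUnitor_eq M := by
    apply Quiver.Hom.unop_inj
    apply ModuleCat.hom_ext
    refine (topMap_leftUnitEquiv M).trans ?_
    rfl
  rightUnitor_eq M := by
    apply Quiver.Hom.unop_inj
    apply ModuleCat.hom_ext
    refine (topMap_rightUnitEquiv M).trans ?_
    rfl

instance : MonoidalCategory (TopFreeVect k) := Monoidal.induced (topFunctor k) topFunctorData

end Category

section Monoids

set_option linter.unusedSectionVars false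

variable {k : Type u} [Field k] [TopologicalSpace k] [DiscreteTopology k]

/-- The element `u ⊛ v` of `M ⊛ N`, with `(u ⊛ v)(ℓ ⊗ r) = ℓ u * r v`. -/
def ostar (M N : TopFreeVect k) : M.obj →ₗ[k] N.obj →ₗ[k] (tensorObj' M N).obj :=
  LinearMap.mk₂ k
    (fun u v => (WeakStar.toDual (StrongDual k M.obj ⊗[k] StrongDual k N.obj)).symm
      (TensorProduct.dualDistrib k _ _
        (WeakStar.toDual _ (gamma M.obj u) ⊗ₜ WeakStar.toDual _ (gamma N.obj v))))
    (fun u u' v => by simp only [map_add, TensorProduct.add_tmul])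
    (fun c u v => by simp only [map_smul, ← TensorProduct.smul_tmul'])
    (fun u v v' => by simp only [map_add, TensorProduct.tmul_add])
    (fun c u v => by simp only [map_smul, TensorProduct.tmul_smul])

theorem toDual_ostar_tmul {M N : TopFreeVect k} (u : M.obj) (v : N.obj)
    (ℓ : StrongDual k M.obj) (r : StrongDual k N.obj) :
    WeakStar.toDual (StrongDual k M.obj ⊗[k] StrongDual k N.obj) (ostar M N u v) (ℓ ⊗ₜ r)
      = ℓ u * r v := rfl

theorem tensor_ext {M N : TopFreeVect k} {x y : (tensorObj' M N).obj}
    (h : ∀ ℓ r, WeakStar.toDual (StrongDual k M.obj ⊗[k] StrongDual k N.obj) x (ℓ ⊗ₜ r) =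
      WeakStar.toDual (StrongDual k M.obj ⊗[k] StrongDual k N.obj) y (ℓ ⊗ₜ r)) : x = y :=
  (WeakStar.toDual (StrongDual k M.obj ⊗[k] StrongDual k N.obj)).injective
    (TensorProduct.ext' h)

theorem tensorMap_ostar {M N P Q : TopFreeVect k} (f : M.obj →L[k] N.obj)
    (g : P.obj →L[k] Q.obj) (u : M.obj) (v : P.obj) :
    tensorMap f g (ostar M P u v) = ostar N Q (f u) (g v) :=
  tensor_ext fun _ _ => rfl

theorem psi_tmul_ostar {M N : TopFreeVect k} (t : StrongDual k M.obj ⊗[k] StrongDual k N.obj)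
    (x : (tensorObj' M N).obj) :
    psi M N t x = WeakStar.toDual (StrongDual k M.obj ⊗[k] StrongDual k N.obj) x t := rfl

theorem assocEquiv_ostar {M N P : TopFreeVect k} (u : M.obj) (v : N.obj) (w : P.obj) :
    assocEquiv M N P (ostar _ P (ostar M N u v) w) = ostar M _ u (ostar N P v w) := by
  apply tensor_ext
  intro ℓ r
  obtain ⟨t, rfl⟩ := (psi N P).surjective r
  have h : ∀ t, WeakStar.toDual (StrongDual k (tensorObj' M N).obj ⊗[k] StrongDual k P.obj)
      (ostar _ P (ostar M N u v) w) (assocDual M N P (ℓ ⊗ₜ psi N P t)) =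
      ℓ u * WeakStar.toDual (StrongDual k N.obj ⊗[k] StrongDual k P.obj) (ostar N P v w) t := by
    intro t
    induction t with
    | zero => simp
    | add x y hx hy => simp only [map_add, TensorProduct.tmul_add, hx, hy, mul_add]
    | tmul a b =>
      simp only [assocDual, LinearEquiv.trans_apply, TensorProduct.congr_tmul,
        LinearEquiv.refl_apply, LinearEquiv.symm_apply_apply, TensorProduct.assoc_symm_tmul]
      exact mul_assoc _ _ _
  exact h t

theorem leftUnitEquiv_ostar {M : TopFreeVect k} (c : k) (u : M.obj) :
    leftUnitEquiv M (ostar unitObj M c u) = c • u := by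
  apply IsTopFree.ext M.property
  intro ℓ
  rw [map_smul]
  refine (apply_gammaEquiv_symm M.property _ ℓ).trans ?_
  change (unitDual (1 : k)) c * ℓ u = _
  simp

theorem rightUnitEquiv_ostar {M : TopFreeVect k} (c : k) (u : M.obj) :
    rightUnitEquiv M (ostar M unitObj u c) = c • u := by
  apply IsTopFree.ext M.property
  intro ℓ
  rw [map_smul]
  refine (apply_gammaEquiv_symm M.property _ ℓ).trans ?_
  change ℓ u * (unitDual (1 : k)) c = _
  simp [mul_comm]

theorem continuous_ostar (M N : TopFreeVect k) :
    Continuous fun x : M.obj × N.obj => ostar M N x.1 x.2 := by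
  refine WeakStar.continuous_of_eval (V := StrongDual k M.obj ⊗[k] StrongDual k N.obj)
    (g := fun x : M.obj × N.obj => ostar M N x.1 x.2) fun t => ?_
  induction t with
  | zero => simpa only [map_zero] using continuous_const
  | add x y hx hy => simpa only [map_add] using Continuous.fun_add hx hy
  | tmul ℓ r =>
    exact (ℓ.continuous.comp continuous_fst).mul (r.continuous.comp continuous_snd)

/-- The multiplication `μ : A ⊛ A → A` of a monoid. -/
def monMul (A : Mon (TopFreeVect k)) : (tensorObj' A.X A.X).obj →L[k] A.X.obj :=
  clm (MonObj.mul (X := A.X))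

/-- The unit `η : k → A` of a monoid. -/
def monOne (A : Mon (TopFreeVect k)) : (unitObj (k := k)).obj →L[k] A.X.obj :=
  clm (MonObj.one (X := A.X))

theorem monMul_assoc (A : Mon (TopFreeVect k)) (u v w : A.X.obj) :
    monMul A (ostar A.X A.X (monMul A (ostar A.X A.X u v)) w) =
      monMul A (ostar A.X A.X u (monMul A (ostar A.X A.X v w))) := by
  have h := congrArg (fun f => clm f (ostar _ A.X (ostar A.X A.X u v) w))
    (MonObj.mul_assoc A.X)
  change monMul A (tensorMap (monMul A) (ContinuousLinearMap.id k A.X.obj)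
      (ostar _ A.X (ostar A.X A.X u v) w)) =
    monMul A (tensorMap (ContinuousLinearMap.id k A.X.obj) (monMul A)
      (assocEquiv A.X A.X A.X (ostar _ A.X (ostar A.X A.X u v) w))) at h
  rw [assocEquiv_ostar, tensorMap_ostar, tensorMap_ostar] at h
  exact h

theorem monMul_one_left (A : Mon (TopFreeVect k)) (u : A.X.obj) :
    monMul A (ostar A.X A.X (monOne A (1 : k)) u) = u := by
  have h := congrArg (fun f => clm f (ostar unitObj A.X (1 : k) u)) (MonObj.one_mul A.X)
  change monMul A (tensorMap (monOne A) (ContinuousLinearMap.id k A.X.obj)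
      (ostar unitObj A.X (1 : k) u)) = leftUnitEquiv A.X (ostar unitObj A.X (1 : k) u) at h
  rw [tensorMap_ostar, leftUnitEquiv_ostar, one_smul] at h
  exact h

theorem monMul_one_right (A : Mon (TopFreeVect k)) (u : A.X.obj) :
    monMul A (ostar A.X A.X u (monOne A (1 : k))) = u := by
  have h := congrArg (fun f => clm f (ostar A.X unitObj u (1 : k))) (MonObj.mul_one A.X)
  change monMul A (tensorMap (ContinuousLinearMap.id k A.X.obj) (monOne A)
      (ostar A.X unitObj u (1 : k))) = rightUnitEquiv A.X (ostar A.X unitObj u (1 : k)) at h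
  rw [tensorMap_ostar, rightUnitEquiv_ostar, one_smul] at h
  exact h

theorem pairTensor_eq_ostar {M N : TopFreeVect k}
    (t : StrongDual k M.obj ⊗[k] StrongDual k N.obj) (u : M.obj) (v : N.obj) :
    pairTensor (ContinuousLinearMap.coeLM k) (ContinuousLinearMap.coeLM k) t (u ⊗ₜ v) =
      psi M N t (ostar M N u v) := by
  induction t with
  | zero => simp
  | add x y hx hy => simp only [map_add, LinearMap.add_apply, _root_.add_apply, hx, hy]
  | tmul x y => rw [pairTensor_tmul]; rfl

theorem pairTensor_psi_symm {M N : TopFreeVect k} (ℓ : StrongDual k (tensorObj' M N).obj)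
    (u : M.obj) (v : N.obj) :
    pairTensor (ContinuousLinearMap.coeLM k) (ContinuousLinearMap.coeLM k) ((psi M N).symm ℓ)
      (u ⊗ₜ v) = ℓ (ostar M N u v) := by
  rw [pairTensor_eq_ostar, LinearEquiv.apply_symm_apply]

/-- The underlying space of the underlying algebra of a monoid `A` in topologically-free spaces:
it has the product `u * v = μ (u ⊛ v)` and the unit `η 1`, and the topology of `A`. -/
def UnderlyingAlgebra (A : Mon (TopFreeVect k)) : Type u := A.X.obj

namespace UnderlyingAlgebra

variable (A : Mon (TopFreeVect k))

instance : AddCommGroup (UnderlyingAlgebra A) := inferInstanceAs (AddCommGroup A.X.obj)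

instance : Module k (UnderlyingAlgebra A) := inferInstanceAs (Module k A.X.obj)

instance : TopologicalSpace (UnderlyingAlgebra A) := inferInstanceAs (TopologicalSpace A.X.obj)

instance : IsTopologicalAddGroup (UnderlyingAlgebra A) :=
  inferInstanceAs (IsTopologicalAddGroup A.X.obj)

instance : ContinuousSMul k (UnderlyingAlgebra A) := inferInstanceAs (ContinuousSMul k A.X.obj)

/-- `μ_bil (u, v) = μ (u ⊛ v)`. -/
def mulBil : UnderlyingAlgebra A →ₗ[k] UnderlyingAlgebra A →ₗ[k] UnderlyingAlgebra A :=
  (ostar A.X A.X).compr₂ (monMul A).toLinearMap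

instance : Ring (UnderlyingAlgebra A) where
  __ := (inferInstance : AddCommGroup (UnderlyingAlgebra A))
  mul u v := mulBil A u v
  one := monOne A (1 : k)
  left_distrib u v w := map_add (mulBil A u) v w
  right_distrib u v w := LinearMap.map_add₂ (mulBil A) u v w
  zero_mul u := LinearMap.map_zero₂ (mulBil A) u
  mul_zero u := map_zero (mulBil A u)
  mul_assoc u v w := monMul_assoc A u v w
  one_mul u := monMul_one_left A u
  mul_one u := monMul_one_right A u

instance : Algebra k (UnderlyingAlgebra A) :=
  Algebra.ofModule (fun c u v => LinearMap.map_smul₂ (mulBil A) c u v)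
    (fun c u v => map_smul (mulBil A u) c v)

/-- The product is jointly continuous, so that `UnderlyingAlgebra A` with its topology is the
underlying topological algebra `TA(A)`. -/
instance : IsTopologicalRing (UnderlyingAlgebra A) where
  continuous_mul := (monMul A).continuous.comp (continuous_ostar A.X A.X)

end UnderlyingAlgebra

/-- The comultiplication `Λ⁻¹ ∘ μ' : A' → (A ⊛ A)' ≃ A' ⊗ A'`. -/
def topDualComul (A : Mon (TopFreeVect k)) : StrongDual k (UnderlyingAlgebra A) →ₗ[k]
    StrongDual k (UnderlyingAlgebra A) ⊗[k] StrongDual k (UnderlyingAlgebra A) :=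
  (psi A.X A.X).symm.toLinearMap ∘ₗ topMap (monMul A)

/-- The counit `ψ⁻¹ ∘ η' : A' → k' ≃ k`. -/
def topDualCounit (A : Mon (TopFreeVect k)) : StrongDual k (UnderlyingAlgebra A) →ₗ[k] k :=
  unitDual.symm.toLinearMap ∘ₗ topMap (monOne A)

/-- The topological dual coalgebra of a monoid `A`. -/
instance topDualCoalgebra (A : Mon (TopFreeVect k)) :
    Coalgebra k (StrongDual k (UnderlyingAlgebra A)) :=
  coalgebraOfPairing (ContinuousLinearMap.coeLM k) ContinuousLinearMap.coe_injective
    (topDualComul A) (topDualCounit A)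
    (fun f a b => pairTensor_psi_symm (topMap (monMul A) f) a b)
    (fun _ => rfl)

end Monoids

end TopFree

end

/-!
The comultiplications of `A'`, of the finite dual `B⁰`, and of any coalgebra `C` viewed as
functionals on its dual algebra `C^*`, are all dual to the product of an algebra. This is captured
by `IsMulPairing`: a linear map `p : V → B^*` from a coalgebra to the functionals on an algebra with
`p f (a * b) = ∑ p f₁ a * p f₂ b` and `p f 1 = ε f`.

Such a `p` always takes values in `B⁰` (`IsMulPairing.mem_finiteDual`). This is local finiteness of
coalgebras: expanding `p f (a * x * b)` by two comultiplications shows that the two-sided ideal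
`{x | ∀ a b, p f (a * x * b) = 0}` contains the common kernel of finitely many functionals. Maps
compatible with the pairings are coalgebra morphisms as soon as the target pairing is injective
(`IsMulPairing.coalgHom`), so an injective `p` embeds `V` in `B⁰` as a subcoalgebra. Dually, `p`
gives an algebra morphism `Γ : B → V^*` (`IsMulPairing.toConvDual`).

Suppose moreover that `Γ` is bijective, as holds for `V = A'` because `A` is topologically-free. Then
`B → (B⁰)^*` followed by restriction along `V → B⁰` is `Γ`, so `B` is reflexive iff the restriction
`(B⁰)^* → V^*` is injective, that is, iff `V → B⁰` is onto. Likewise `V → (V^*)⁰` followed by the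
transport `(V^*)⁰ ≃ B⁰` along `Γ` is `V → B⁰`, so `V` is coreflexive iff `V → B⁰` is onto.

The topology enters only in comparing closed ideals with `A' = A⁰`. An ideal of finite codimension
is the intersection of the kernels of the functionals in `A⁰` that vanish on it, so it is closed
when these are all continuous. Conversely, a closed subspace of finite codimension contains a basic
open subspace `U`, by minimality of `W + U` over `W` (`exists_finset_le_of_isClosed_of_finite`), so
every functional vanishing on it is continuous.
-/

open CategoryTheory MonoidalCategory TensorProduct

noncomputable section

namespace FinDual

/-! ### Pairings of a coalgebra with an algebra -/

section MulPairing

variable {k : Type*} [Field k] {V W B B' : Type*} [AddCommGroup V] [Module k V]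
  [AddCommGroup W] [Module k W] [Ring B] [Algebra k B] [Ring B'] [Algebra k B']

variable (k V) in
/-- The evaluation pairing `c ↦ (ℓ ↦ ℓ c)` of a coalgebra with its dual algebra. -/
def convEval : V →ₗ[k] Module.Dual k (WithConv (V →ₗ[k] k)) where
  toFun c := LinearMap.applyₗ c ∘ₗ (WithConv.linearEquiv k (V →ₗ[k] k)).toLinearMap
  map_add' c d := by ext; simp
  map_smul' r c := by ext; simp

@[simp]
theorem convEval_apply (c : V) (ℓ : WithConv (V →ₗ[k] k)) : convEval k V c ℓ = ℓ.ofConv c := rfl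

theorem convEval_injective : Function.Injective (convEval k V) := by
  rw [injective_iff_map_eq_zero]
  intro c hc
  rw [← Module.forall_dual_apply_eq_zero_iff k]
  exact fun φ => LinearMap.congr_fun hc (WithConv.toConv φ)

variable [Coalgebra k V] [Coalgebra k W]

/-- A linear map `p` from a coalgebra `V` to the functionals on an algebra `B` for which the
comultiplication of `V` is dual to the product of `B`, and the counit is evaluation at `1`. -/
structure IsMulPairing (p : V →ₗ[k] Module.Dual k B) : Prop where
  comul : ∀ f a b, pairTensor p p (Coalgebra.comul (R := k) f) (a ⊗ₜ b) = p f (a * b)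
  counit : ∀ f, Coalgebra.counit (R := k) f = p f 1

theorem pairTensor_map {V V' W W' B C : Type*} [AddCommGroup V] [Module k V]
    [AddCommGroup V'] [Module k V'] [AddCommGroup W] [Module k W] [AddCommGroup W'] [Module k W']
    [AddCommGroup B] [Module k B] [AddCommGroup C] [Module k C]
    (p : V' →ₗ[k] Module.Dual k B) (q : W' →ₗ[k] Module.Dual k C) (i : V →ₗ[k] V')
    (j : W →ₗ[k] W') (t : V ⊗[k] W) :
    pairTensor p q (TensorProduct.map i j t) = pairTensor (p ∘ₗ i) (q ∘ₗ j) t := by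
  simp only [pairTensor, TensorProduct.map_comp, LinearMap.comp_apply]

theorem isMulPairing_finiteDual : IsMulPairing (V := finiteDual k B) (finiteDual k B).subtype where
  comul f a b := by
    have h := LinearEquiv.apply_symm_apply
      (LinearEquiv.ofInjective _ (finiteDualPair_injective k B)) (finiteDualMul k B f)
    exact LinearMap.congr_fun (congrArg Subtype.val h) (a ⊗ₜ b)
  counit _ := rfl

theorem isMulPairing_convEval : IsMulPairing (convEval k V) where
  comul f a b := by
    have h : ∀ t : V ⊗[k] V, pairTensor (convEval k V) (convEval k V) t (a ⊗ₜ b) =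
        LinearMap.mul' k k (TensorProduct.map a.ofConv b.ofConv t) := by
      intro t
      induction t with
      | zero => simp
      | add x y hx hy => simp only [map_add, LinearMap.add_apply, hx, hy]
      | tmul x y => simp
    exact h _
  counit _ := rfl

theorem finite_quotient_of_ker_le {F : Type*} [AddCommGroup F] [Module k F] [Module.Finite k F]
    (φ : B →ₗ[k] F) (I : Ideal B) (h : LinearMap.ker φ ≤ I.restrictScalars k) :
    Module.Finite k (B ⧸ I) := by
  have h1 : Module.Finite k (B ⧸ LinearMap.ker φ) := Module.Finite.equiv φ.quotKerEquivRange.symm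
  have h2 : Module.Finite k (B ⧸ I.restrictScalars k) :=
    Module.Finite.of_surjective (Submodule.factor h) (Submodule.factor_surjective h)
  exact h2

namespace IsMulPairing

variable {p : V →ₗ[k] Module.Dual k B} {q : W →ₗ[k] Module.Dual k B}

/-- Functionals on `B` can be restricted along an algebra morphism `B' → B`; with `mem_finiteDual`
this makes `B ↦ B⁰` functorial. -/
theorem comp_algHom (hp : IsMulPairing p) (φ : B' →ₐ[k] B) :
    IsMulPairing (Module.Dual.transpose (R := k) φ.toLinearMap ∘ₗ p) where
  comul f a b := by
    have h : ∀ t : V ⊗[k] V,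
        pairTensor (Module.Dual.transpose (R := k) φ.toLinearMap ∘ₗ p)
          (Module.Dual.transpose (R := k) φ.toLinearMap ∘ₗ p) t (a ⊗ₜ b) =
        pairTensor p p t (φ a ⊗ₜ φ b) := by
      intro t
      induction t with
      | zero => simp
      | add x y hx hy => simp only [map_add, LinearMap.add_apply, hx, hy]
      | tmul x y => simp [Module.Dual.transpose_apply]
    rw [h, hp.comul]
    simp [Module.Dual.transpose_apply]
  counit f := by simp [Module.Dual.transpose_apply, hp.counit]

theorem apply_mul (hp : IsMulPairing p) {ι : Type*} {f : V} (r : Coalgebra.Repr k f ι) (a b : B) :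
    p f (a * b) = ∑ i ∈ r.index, p (r.left i) a * p (r.right i) b := by
  rw [← hp.comul, ← r.eq]
  simp

/-- Local finiteness of coalgebras: every functional `p f` vanishes on a two-sided ideal of finite
codimension. -/
theorem mem_finiteDual (hp : IsMulPairing p) (f : V) : p f ∈ finiteDual k B := by
  let I : Ideal B :=
    { carrier := {x | ∀ a b, p f (a * x * b) = 0}
      zero_mem' := by simp
      add_mem' := fun hx hy a b => by rw [mul_add, add_mul, map_add, hx, hy, add_zero]
      smul_mem' := fun c x hx a b => by rw [smul_eq_mul, ← mul_assoc a c x]; exact hx _ _ }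
  have hI : I.IsTwoSided := ⟨fun c hx a b => by
    rw [← mul_assoc a, mul_assoc _ c b]; exact hx _ _⟩
  refine ⟨I, hI, ?_, fun x hx => by simpa using hx 1 1⟩
  -- `p f (a * x * b)` is a sum of multiples of the values at `x` of the finitely many functionals
  -- `p ((s i).right j)`, which do not depend on `a` and `b`
  have r := Coalgebra.Repr.arbitrary k f
  have s := fun i => Coalgebra.Repr.arbitrary k (r.left i)
  let φ : B →ₗ[k] ((i : r.index) → (s i).index → k) :=
    LinearMap.pi fun i => LinearMap.pi fun j => p ((s i).right j)
  have : Module.Finite k ((i : r.index) → (s i).index → k) := Module.Finite.pi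
  refine finite_quotient_of_ker_le φ I fun x hx => ?_
  change ∀ a b, p f (a * x * b) = 0
  intro a b
  rw [hp.apply_mul r]
  refine Finset.sum_eq_zero fun i hi => ?_
  rw [hp.apply_mul (s i), Finset.sum_eq_zero, zero_mul]
  intro j hj
  have : p ((s i).right j) x = 0 := congrFun (congrFun hx ⟨i, hi⟩) ⟨j, hj⟩
  rw [this, mul_zero]

/-- A linear map compatible with pairings of two coalgebras with the same algebra is a morphism of
coalgebras if the pairing of its target is injective. -/
def coalgHom (hp : IsMulPairing p) (hq : IsMulPairing q) (hq' : Function.Injective q)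
    (j : V →ₗ[k] W) (hj : q ∘ₗ j = p) : V →ₗc[k] W where
  toLinearMap := j
  counit_comp := by
    ext f
    simp only [LinearMap.comp_apply, hp.counit, hq.counit, ← hj]
  map_comp_comul := by
    ext f
    apply pairTensor_injective hq' hq'
    apply TensorProduct.ext'
    intro a b
    simp only [LinearMap.comp_apply]
    rw [pairTensor_map, hj, hp.comul, hq.comul, ← hj, LinearMap.comp_apply]

/-- The morphism of coalgebras `V → B⁰` given by a pairing of `V` with `B`. -/
def toFiniteDual (hp : IsMulPairing p) : V →ₗc[k] finiteDual k B :=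
  hp.coalgHom isMulPairing_finiteDual (finiteDual_subtype_injective k B)
    (p.codRestrict (finiteDual k B) hp.mem_finiteDual) rfl

@[simp]
theorem coe_toFiniteDual (hp : IsMulPairing p) (f : V) :
    (hp.toFiniteDual f : Module.Dual k B) = p f := rfl

theorem toFiniteDual_injective (hp : IsMulPairing p) (hp' : Function.Injective p) :
    Function.Injective hp.toFiniteDual :=
  fun _ _ h => hp' (congrArg Subtype.val h)

/-- For an injective pairing `V → B^*`, the space `V` is all of `B⁰` iff it is isomorphic to `B⁰`
as a coalgebra of functionals. -/
theorem surjective_toFiniteDual_iff (hp : IsMulPairing p) (hp' : Function.Injective p) :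
    Function.Surjective hp.toFiniteDual ↔
      ∃ e : V ≃ₗc[k] finiteDual k B, ∀ f, (e f : Module.Dual k B) = p f := by
  refine ⟨fun h => ⟨CoalgEquiv.ofBijective (f := hp.toFiniteDual)
    ⟨hp.toFiniteDual_injective hp', h⟩, fun f => rfl⟩, ?_⟩
  rintro ⟨e, he⟩ g
  obtain ⟨f, rfl⟩ := e.surjective g
  exact ⟨f, Subtype.ext (he f).symm⟩

/-- The morphism of algebras `Γ : B → V^*`, `u ↦ (f ↦ p f u)`. -/
def toConvDual (hp : IsMulPairing p) : B →ₐ[k] WithConv (V →ₗ[k] k) :=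
  AlgHom.ofLinearMap ((WithConv.linearEquiv k (V →ₗ[k] k)).symm.toLinearMap ∘ₗ p.flip)
    (by
      ext f
      exact (hp.counit f).symm)
    (fun a b => by
      ext f
      refine (hp.apply_mul (Coalgebra.Repr.arbitrary k f) a b).trans ?_
      exact ((Coalgebra.Repr.arbitrary k f).convMul_apply (A := k) (WithConv.toConv (p.flip a))
        (WithConv.toConv (p.flip b))).symm)

@[simp]
theorem ofConv_toConvDual (hp : IsMulPairing p) (u : B) (f : V) :
    (hp.toConvDual u).ofConv f = p f u := rfl

/-! ### Reflexivity and coreflexivity -/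

/-- Restriction along `V → B⁰` turns the evaluation map `B → (B⁰)^*` into the bijection `Γ`, so the
former is bijective iff no nonzero functional on `B⁰` vanishes on `V`. -/
theorem isReflexive_iff (hp : IsMulPairing p) (hΓ : Function.Bijective hp.toConvDual) :
    IsReflexive k B ↔ Function.Surjective hp.toFiniteDual := by
  constructor
  · rintro ⟨e, he⟩ g
    by_contra hg
    let R : Submodule k (finiteDual k B) := LinearMap.range hp.toFiniteDual.toLinearMap
    have hg' : g ∉ R := hg
    -- a nonzero functional on `B⁰` vanishing on `V` would be evaluation at some `u ≠ 0` in `ker Γ`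
    obtain ⟨L, hLg, hL⟩ := Submodule.exists_dual_map_eq_bot_of_notMem
      (M := finiteDual k B) (p := R) hg' inferInstance
    obtain ⟨u, hu⟩ := e.surjective (WithConv.toConv L)
    have hLu : ∀ ℓ, L ℓ = (ℓ : Module.Dual k B) u := fun ℓ => by rw [← he, hu]
    have hu0 : u = 0 := by
      apply hΓ.1
      ext f
      rw [ofConv_toConvDual, map_zero, ← coe_toFiniteDual hp, ← hLu]
      have : L (hp.toFiniteDual f) ∈ R.map L := ⟨_, ⟨f, rfl⟩, rfl⟩
      rw [hL] at this
      exact this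
    exact hLg (by rw [hLu, hu0, map_zero])
  · intro h
    have hfd := isMulPairing_finiteDual (k := k) (B := B)
    refine ⟨AlgEquiv.ofBijective hfd.toConvDual ⟨fun u v huv => hΓ.1 ?_, fun L => ?_⟩,
      fun u ℓ => rfl⟩
    · ext f
      exact LinearMap.congr_fun (congrArg WithConv.ofConv huv) (hp.toFiniteDual f)
    · obtain ⟨u, hu⟩ := hΓ.2 (WithConv.toConv
        (L.ofConv ∘ₗ hp.toFiniteDual.toLinearMap))
      refine ⟨u, ?_⟩
      ext g
      obtain ⟨f, rfl⟩ := h g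
      exact LinearMap.congr_fun (congrArg WithConv.ofConv hu) f

/-- Transport along `Γ` identifies the evaluation map `V → (V^*)⁰` with `V → B⁰`. -/
theorem isCoreflexive_iff (hp : IsMulPairing p) (hΓ : Function.Bijective hp.toConvDual) :
    IsCoreflexive k V ↔ Function.Surjective hp.toFiniteDual := by
  let Γ : B ≃ₐ[k] WithConv (V →ₗ[k] k) := AlgEquiv.ofBijective hp.toConvDual hΓ
  have hΓp : ∀ u f, (Γ u).ofConv f = p f u := fun _ _ => rfl
  have hev := isMulPairing_convEval (k := k) (V := V)
  calc IsCoreflexive k V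
    _ ↔ ∃ e : V ≃ₗc[k] finiteDual k (WithConv (V →ₗ[k] k)),
          ∀ c, (e c : Module.Dual k (WithConv (V →ₗ[k] k))) = convEval k V c :=
      ⟨fun ⟨e, he⟩ => ⟨e, fun c => LinearMap.ext (he c)⟩,
        fun ⟨e, he⟩ => ⟨e, fun c ℓ => LinearMap.congr_fun (he c) ℓ⟩⟩
    _ ↔ Function.Surjective hev.toFiniteDual :=
      (hev.surjective_toFiniteDual_iff convEval_injective).symm
    _ ↔ Function.Surjective hp.toFiniteDual := ?_
  constructor
  · intro h g
    obtain ⟨c, hc⟩ := h ⟨_, (isMulPairing_finiteDual.comp_algHom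
      (Γ.symm : WithConv (V →ₗ[k] k) →ₐ[k] B)).mem_finiteDual g⟩
    refine ⟨c, Subtype.ext (LinearMap.ext fun u => ?_)⟩
    have := LinearMap.congr_fun (congrArg Subtype.val hc) (Γ u)
    simpa [Module.Dual.transpose_apply, hΓp] using this
  · intro h g
    obtain ⟨c, hc⟩ := h ⟨_, (isMulPairing_finiteDual.comp_algHom
      (Γ : B →ₐ[k] WithConv (V →ₗ[k] k))).mem_finiteDual g⟩
    refine ⟨c, Subtype.ext (LinearMap.ext fun L => ?_)⟩
    obtain ⟨u, rfl⟩ := Γ.surjective L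
    have := LinearMap.congr_fun (congrArg Subtype.val hc) u
    simpa [Module.Dual.transpose_apply, hΓp] using this

end IsMulPairing

end MulPairing

end FinDual

namespace TopFree

open FinDual

/-! ### Closed subspaces of finite codimension -/

section Closed

variable {k : Type*} [Field k] [TopologicalSpace k]
  {E : Type*} [AddCommGroup E] [Module k E] [TopologicalSpace E]

/-- A closed subspace of finite codimension in a space isomorphic to `k^X` contains all vectors
whose coordinates vanish on a suitable finite set. -/
theorem exists_finset_le_of_isClosed_of_finite {X : Type*} (θ : E ≃L[k] (X → k))
    (W : Submodule k E) (hW : IsClosed (W : Set E)) [Module.Finite k (E ⧸ W)] :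
    ∃ s : Finset X, ∀ u, (∀ x ∈ s, θ u x = 0) → u ∈ W := by
  classical
  let U : Finset X → Submodule k E := fun s =>
    { carrier := {u | ∀ x ∈ s, θ u x = 0}
      zero_mem' := by simp
      add_mem' := fun hu hv x hx => by simp [hu x hx, hv x hx]
      smul_mem' := fun c u hu x hx => by simp [hu x hx] }
  have hU : Antitone U := fun s t hst u hu x hx => hu x (hst hx)
  -- `W + U s` takes a minimal value, which lies in the closure of `W`
  obtain ⟨_, ⟨s, rfl⟩, hs⟩ := IsArtinian.set_has_minimal
    (Set.range fun s => (U s).map W.mkQ) (Set.range_nonempty _)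
  refine ⟨s, fun u hu => ?_⟩
  have hcl : u ∈ closure (W : Set E) := by
    rw [mem_closure_iff]
    intro O hO huO
    have hO' : IsOpen (θ.symm ⁻¹' O) := hO.preimage θ.symm.continuous
    obtain ⟨t, v, hv, htv⟩ := isOpen_pi_iff.mp hO' (θ u) (by simpa using huO)
    have hle : (U (s ∪ t)).map W.mkQ ≤ (U s).map W.mkQ :=
      Submodule.map_mono (hU Finset.subset_union_left)
    have heq : (U (s ∪ t)).map W.mkQ = (U s).map W.mkQ :=
      hle.eq_of_not_lt (hs _ ⟨s ∪ t, rfl⟩)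
    have hmem : W.mkQ u ∈ (U (s ∪ t)).map W.mkQ := heq ▸ ⟨u, hu, rfl⟩
    obtain ⟨y, hy, hyu⟩ := hmem
    refine ⟨u - y, ?_, ?_⟩
    · have : θ (u - y) ∈ θ.symm ⁻¹' O := htv fun x hx => by
        rw [map_sub, Pi.sub_apply, hy x (Finset.mem_union_right _ hx), sub_zero]
        exact (hv x hx).2
      simpa using this
    · exact (Submodule.Quotient.eq W).mp hyu.symm
  rwa [hW.closure_eq] at hcl

theorem continuous_of_isClosed_of_finite [DiscreteTopology k] [IsTopologicalAddGroup E]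
    (hE : IsTopFree k E) (W : Submodule k E) (hW : IsClosed (W : Set E)) [Module.Finite k (E ⧸ W)]
    (f : Module.Dual k E) (hf : ∀ u ∈ W, f u = 0) : Continuous f := by
  obtain ⟨X, ⟨θ⟩⟩ := hE
  obtain ⟨s, hs⟩ := exists_finset_le_of_isClosed_of_finite θ W hW
  apply continuous_of_continuousAt_zero f
  have h : ∀ᶠ u in nhds (0 : E), ∀ x ∈ s, θ u x = 0 := by
    rw [Filter.eventually_all_finset]
    intro x _
    have hx : IsOpen {u : E | θ u x = 0} :=
      (isOpen_discrete {0}).preimage ((continuous_apply x).comp θ.continuous)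
    exact hx.mem_nhds (by simp)
  refine ContinuousAt.congr (f := fun _ => (0 : k)) continuousAt_const ?_
  filter_upwards [h] with u hu
  exact (hf u (hs u hu)).symm

end Closed

/-! ### The topological dual coalgebra -/

section TopDual

variable {k : Type u} [Field k] [TopologicalSpace k] [DiscreteTopology k]
  (A : Mon (TopFreeVect k))

theorem isTopFree_underlyingAlgebra : IsTopFree k (UnderlyingAlgebra A) := A.X.property

theorem isMulPairing_topDual : IsMulPairing (V := StrongDual k (UnderlyingAlgebra A))
    (B := UnderlyingAlgebra A) (ContinuousLinearMap.coeLM k) where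
  comul f a b := pairTensor_psi_symm (topMap (monMul A) f) a b
  counit _ := rfl

/-- A topologically-free algebra is the dual algebra of its topological dual coalgebra; on the
underlying spaces `Γ` is `TopFree.gamma`. -/
theorem bijective_toConvDual_topDual :
    Function.Bijective (isMulPairing_topDual A).toConvDual := by
  have h := isTopFree_underlyingAlgebra A
  constructor
  · intro u v huv
    exact h.ext fun ℓ => LinearMap.congr_fun (congrArg WithConv.ofConv huv) ℓ
  · intro L
    refine ⟨(gammaEquiv h).symm ((WeakStar.toDual _).symm L.ofConv), ?_⟩
    ext ℓ
    exact apply_gammaEquiv_symm h _ ℓ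

theorem isClosed_iff_surjective_toFiniteDual :
    (∀ I : Ideal (UnderlyingAlgebra A), I.IsTwoSided →
      Module.Finite k (UnderlyingAlgebra A ⧸ I) → IsClosed (I : Set (UnderlyingAlgebra A))) ↔
    Function.Surjective (isMulPairing_topDual A).toFiniteDual := by
  constructor
  · rintro h ⟨f, I, hI, hfin, hf⟩
    have : Module.Finite k (UnderlyingAlgebra A ⧸ I.restrictScalars k) := hfin
    have hc : Continuous f := continuous_of_isClosed_of_finite (isTopFree_underlyingAlgebra A)
      (I.restrictScalars k) (h I hI hfin) f hf
    exact ⟨⟨f, hc⟩, rfl⟩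
  · intro h I hI hfin
    refine isClosed_of_closure_subset fun u hu => ?_
    by_contra huI
    obtain ⟨f, hfu, hfI⟩ := Submodule.exists_dual_map_eq_bot_of_notMem
      (p := I.restrictScalars k) huI inferInstance
    have hf : ∀ x ∈ I, f x = 0 := fun x hx => by
      have : f x ∈ (I.restrictScalars k).map f := ⟨x, hx, rfl⟩
      rw [hfI] at this
      exact this
    obtain ⟨ℓ, hℓ⟩ := h ⟨f, I, hI, hfin, hf⟩
    have hℓf : ∀ x, ℓ x = f x := LinearMap.congr_fun (congrArg Subtype.val hℓ)
    have hcl : IsClosed {x | ℓ x = 0} := isClosed_eq ℓ.continuous continuous_const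
    have hsub : closure (I : Set (UnderlyingAlgebra A)) ⊆ {x | ℓ x = 0} :=
      closure_minimal (fun x hx => (hℓf x).trans (hf x hx)) hcl
    exact hfu ((hℓf u).symm.trans (hsub hu))

end TopDual

end TopFree

end

theorem mainTheorem4 {k : Type u} [Field k] [TopologicalSpace k] [DiscreteTopology k]
    (A : Mon (TopFree.TopFreeVect k)) :
    (∃ ι : StrongDual k (TopFree.UnderlyingAlgebra A) →ₗc[k]
          FinDual.finiteDual k (TopFree.UnderlyingAlgebra A),
        ∀ ℓ : StrongDual k (TopFree.UnderlyingAlgebra A),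
          (ι ℓ : Module.Dual k (TopFree.UnderlyingAlgebra A)) = ℓ.toLinearMap) ∧
    List.TFAE
      [∀ I : Ideal (TopFree.UnderlyingAlgebra A), I.IsTwoSided →
          Module.Finite k (TopFree.UnderlyingAlgebra A ⧸ I) →
          IsClosed (I : Set (TopFree.UnderlyingAlgebra A)),
        FinDual.IsReflexive k (TopFree.UnderlyingAlgebra A),
        FinDual.IsCoreflexive k (StrongDual k (TopFree.UnderlyingAlgebra A)),
        ∃ e : StrongDual k (TopFree.UnderlyingAlgebra A) ≃ₗc[k]
            FinDual.finiteDual k (TopFree.UnderlyingAlgebra A),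
          ∀ ℓ : StrongDual k (TopFree.UnderlyingAlgebra A),
            (e ℓ : Module.Dual k (TopFree.UnderlyingAlgebra A)) = ℓ.toLinearMap] := by
  have hp := TopFree.isMulPairing_topDual A
  have hinj : Function.Injective (ContinuousLinearMap.coeLM k :
      StrongDual k (TopFree.UnderlyingAlgebra A) →ₗ[k] _) := ContinuousLinearMap.coe_injective
  have hΓ := TopFree.bijective_toConvDual_topDual A
  refine ⟨⟨hp.toFiniteDual, fun _ => rfl⟩, ?_⟩
  tfae_have 1 ↔ 4 := (TopFree.isClosed_iff_surjective_toFiniteDual A).trans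
    (hp.surjective_toFiniteDual_iff hinj)
  tfae_have 2 ↔ 4 := (hp.isReflexive_iff hΓ).trans (hp.surjective_toFiniteDual_iff hinj)
  tfae_have 3 ↔ 4 := (hp.isCoreflexive_iff hΓ).trans (hp.surjective_toFiniteDual_iff hinj)
  tfae_finish
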